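/- Let \(q\) be a non-zero complex number with \(|q|\neq 1\), and fix a square root \(q^{1/2}\) of \(q\). Let \(\mathfrak{osp}_q(1|2)\) be the unital associative \(\mathbb{C}\)-algebra with generators \(A_+,A_-,K,K^{-1},P\) and relations \[ KA_{+}K^{-1} = q^{1/2} A_{+},\quad KA_{-}K^{-1} = q^{-1/2} A_{-},\quad A_+A_-+A_-A_+ = \frac{K^2-K^{-2}}{q^{1/2}-q^{-1/2}}, \] \[ PA_\pm+A_\pm P=0,\quad PK=KP,\quad PK^{-1}=K^{-1}P,\quad KK^{-1}=K^{-1}K=1,\quad P^2=1 . \] Tensor powers of this algebra carry the product \((a_1\otimes\dots\otimes a_n)(b_1\otimes\dots\otimes b_n)=a_1b_1\otimes\dots\otimes a_nb_n\). Let \(\Delta:\mathfrak{osp}_q(1|2)\to\mathfrak{osp}_q(1|2)\otimes\mathfrak{osp}_q(1|2)\) be the algebra morphism with \[ \Delta(A_\pm)=A_\pm\otimes KP+K^{-1}\otimes A_\pm,\quad \Delta(K^{\pm1})=K^{\pm1}\otimes K^{\pm1},\quad \Delta(P)=P\otimes P, \] and let \[ \Gamma^q=\left(-A_+A_-+\frac{q^{-1/2}K^2-q^{1/2}K^{-2}}{q-q^{-1}}\right)P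 . \] For \(1\le i\le j\le n\) and the set of consecutive integers \([i;j]=\{i,i+1,\dots,j\}\), put \[ \Gamma^q_{[i;j]}=\underbrace{1\otimes\dots\otimes1}_{i-1}\otimes\Big[(\underbrace{1\otimes\dots\otimes1}_{j-i-1}\otimes\Delta)\cdots(1\otimes\Delta)\Delta(\Gamma^q)\Big]\otimes\underbrace{1\otimes\dots\otimes1}_{n-j}\ \in\ \mathfrak{osp}_q(1|2)^{\otimes n}, \] where the bracket contains \(j-i\) extension morphisms (so it is \(\Gamma^q\) itself if \(i=j\)). Write \([m]=[1;m]\). Then for all \(n\ge 3\) and all \(m\in\{2,3,\dots,n-1\}\), the elements \(A=\Gamma^q_{[m]}\) and \(A^*=\Gamma^q_{\{m,m+1\}}\) of \(\mathfrak{osp}_q(1|2)^{\otimes n}\) satisfy the tridiagonal relations \[ [A,\,A^2A^*+A^*A^2-\beta AA^*A-\gamma(AA^*+A^*A)-\rho A^*]=0, \] \[ [A^*,\,{A^*}^2A+A{A^*}^2-\beta A^*AA^*-\gamma^*(A^*A+AA^*)-\rho^*A]=0, \] with \(\beta=-(q+q^{-1})\), \(\gamma=\gamma^*=0\) and \(\rho=\rho^*=1\),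 where \([X,Y]=XY-YX\). -/

import Mathlib

open scoped TensorProduct

noncomputable section

namespace QBannaiIto

/-! ## The quantum superalgebra `osp_q(1|2)`

Throughout, `s` is a fixed square root of the deformation parameter, i.e. `q = s ^ 2`,
`q ^ (1/2) = s` and `q ^ (-1/2) = s⁻¹`. -/

/-- Names of the generators `A₊, A₋, K, K⁻¹, P`. -/
inductive Gen : Type
  | Ap | Am | K | Kinv | P

namespace Free

/-- The free generators. -/
abbrev Ap : FreeAlgebra ℂ Gen := FreeAlgebra.ι ℂ Gen.Ap
abbrev Am : FreeAlgebra ℂ Gen := FreeAlgebra.ι ℂ Gen.Am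
abbrev K : FreeAlgebra ℂ Gen := FreeAlgebra.ι ℂ Gen.K
abbrev Kinv : FreeAlgebra ℂ Gen := FreeAlgebra.ι ℂ Gen.Kinv
abbrev P : FreeAlgebra ℂ Gen := FreeAlgebra.ι ℂ Gen.P

end Free

open Free in
/-- The defining relations of `osp_q(1|2)`. -/
inductive Rel (s : ℂ) : FreeAlgebra ℂ Gen → FreeAlgebra ℂ Gen → Prop
  | K_Ap : Rel s (K * Ap * Kinv) (s • Ap)
  | K_Am : Rel s (K * Am * Kinv) (s⁻¹ • Am)
  | Ap_Am : Rel s (Ap * Am + Am * Ap) ((s - s⁻¹)⁻¹ • (K ^ 2 - Kinv ^ 2))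
  | P_Ap : Rel s (P * Ap + Ap * P) 0
  | P_Am : Rel s (P * Am + Am * P) 0
  | P_K : Rel s (P * K) (K * P)
  | P_Kinv : Rel s (P * Kinv) (Kinv * P)
  | K_Kinv : Rel s (K * Kinv) 1
  | Kinv_K : Rel s (Kinv * K) 1
  | P_P : Rel s (P ^ 2) 1

/-- The unital associative complex algebra `osp_q(1|2)` with `q = s ^ 2`, given by generators
and relations. -/
def Osp (s : ℂ) : Type := RingQuot (Rel s)

instance (s : ℂ) : Ring (Osp s) := inferInstanceAs (Ring (RingQuot (Rel s)))

instance (s : ℂ) : Algebra ℂ (Osp s) := inferInstanceAs (Algebra ℂ (RingQuot (Rel s)))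

namespace Osp

variable (s : ℂ)

/-- The quotient map from the free algebra. -/
def mk : FreeAlgebra ℂ Gen →ₐ[ℂ] Osp s := RingQuot.mkAlgHom ℂ (Rel s)

/-- The generators `A₊, A₋, K, K⁻¹, P` of `osp_q(1|2)`. -/
def Ap : Osp s := mk s Free.Ap
def Am : Osp s := mk s Free.Am
def K : Osp s := mk s Free.K
def Kinv : Osp s := mk s Free.Kinv
def P : Osp s := mk s Free.P

variable {s}

theorem mk_rel {x y : FreeAlgebra ℂ Gen} (h : Rel s x y) : mk s x = mk s y :=
  RingQuot.mkAlgHom_rel ℂ h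

theorem K_Ap_Kinv : K s * Ap s * Kinv s = s • Ap s := by
  simpa [Ap, Am, K, Kinv, P] using mk_rel (Rel.K_Ap (s := s))

theorem K_Am_Kinv : K s * Am s * Kinv s = s⁻¹ • Am s := by
  simpa [Ap, Am, K, Kinv, P] using mk_rel (Rel.K_Am (s := s))

theorem Ap_Am : Ap s * Am s + Am s * Ap s = (s - s⁻¹)⁻¹ • (K s ^ 2 - Kinv s ^ 2) := by
  simpa [Ap, Am, K, Kinv, P] using mk_rel (Rel.Ap_Am (s := s))

theorem P_Ap : P s * Ap s + Ap s * P s = 0 := by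
  simpa [Ap, Am, K, Kinv, P] using mk_rel (Rel.P_Ap (s := s))

theorem P_Am : P s * Am s + Am s * P s = 0 := by
  simpa [Ap, Am, K, Kinv, P] using mk_rel (Rel.P_Am (s := s))

theorem P_K : P s * K s = K s * P s := by
  simpa [Ap, Am, K, Kinv, P] using mk_rel (Rel.P_K (s := s))

theorem P_Kinv : P s * Kinv s = Kinv s * P s := by
  simpa [Ap, Am, K, Kinv, P] using mk_rel (Rel.P_Kinv (s := s))

theorem K_Kinv : K s * Kinv s = 1 := by
  simpa [Ap, Am, K, Kinv, P] using mk_rel (Rel.K_Kinv (s := s))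

theorem Kinv_K : Kinv s * K s = 1 := by
  simpa [Ap, Am, K, Kinv, P] using mk_rel (Rel.Kinv_K (s := s))

theorem P_P : P s * P s = 1 := by
  simpa [P, pow_two] using mk_rel (Rel.P_P (s := s))

theorem Ap_Kinv : Ap s * Kinv s = s • (Kinv s * Ap s) := by
  rw [← mul_smul_comm, ← K_Ap_Kinv, ← mul_assoc, ← mul_assoc, Kinv_K, one_mul]

theorem Am_Kinv : Am s * Kinv s = s⁻¹ • (Kinv s * Am s) := by
  rw [← mul_smul_comm, ← K_Am_Kinv, ← mul_assoc, ← mul_assoc, Kinv_K, one_mul]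

theorem K_Ap : K s * Ap s = s • (Ap s * K s) := by
  rw [← smul_mul_assoc, ← K_Ap_Kinv, mul_assoc, Kinv_K, mul_one]

theorem K_Am : K s * Am s = s⁻¹ • (Am s * K s) := by
  rw [← smul_mul_assoc, ← K_Am_Kinv, mul_assoc, Kinv_K, mul_one]

theorem K_P_K_P : K s * P s * (K s * P s) = K s ^ 2 := by
  rw [mul_assoc, ← mul_assoc (P s), P_K, mul_assoc (K s) (P s), P_P, mul_one, pow_two]

/-- The Casimir element
`Γ = (-A₊A₋ + (q^(-1/2) K² - q^(1/2) K⁻²) / (q - q⁻¹)) P`. -/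
def casimir (s : ℂ) : Osp s :=
  (-(Ap s * Am s)
    + (s ^ 2 - (s ^ 2)⁻¹)⁻¹ • (s⁻¹ • K s ^ 2 - s • Kinv s ^ 2)) * P s

/-- The values of the coproduct on the generators:
`Δ(A±) = A± ⊗ KP + K⁻¹ ⊗ A±`, `Δ(K^{±1}) = K^{±1} ⊗ K^{±1}`, `Δ(P) = P ⊗ P`. -/
def comulGen (s : ℂ) : Gen → Osp s ⊗[ℂ] Osp s
  | .Ap => Ap s ⊗ₜ (K s * P s) + Kinv s ⊗ₜ Ap s
  | .Am => Am s ⊗ₜ (K s * P s) + Kinv s ⊗ₜ Am s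
  | .K => K s ⊗ₜ K s
  | .Kinv => Kinv s ⊗ₜ Kinv s
  | .P => P s ⊗ₜ P s

theorem comulGen_rel (s : ℂ) {x y : FreeAlgebra ℂ Gen} (h : Rel s x y) :
    FreeAlgebra.lift ℂ (comulGen s) x = FreeAlgebra.lift ℂ (comulGen s) y := by
  cases h <;> simp only [map_mul, map_add, map_smul, map_sub, map_one, map_zero,
    FreeAlgebra.lift_ι_apply, comulGen, mul_add, add_mul, pow_two,
    Algebra.TensorProduct.tmul_mul_tmul]
  case K_Ap =>
    rw [K_Ap_Kinv, K_Kinv, one_mul, smul_add, TensorProduct.smul_tmul',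
      TensorProduct.tmul_smul, ← P_K, ← mul_assoc (K s) (P s), mul_assoc _ (K s) (Kinv s),
      K_Kinv, mul_one, P_K]
  case K_Am =>
    rw [K_Am_Kinv, K_Kinv, one_mul, smul_add, TensorProduct.smul_tmul',
      TensorProduct.tmul_smul, ← P_K, ← mul_assoc (K s) (P s), mul_assoc _ (K s) (Kinv s),
      K_Kinv, mul_one, P_K]
  case Ap_Am =>
    have hp : P s * Ap s = -(Ap s * P s) := eq_neg_of_add_eq_zero_left P_Ap
    have hm : P s * Am s = -(Am s * P s) := eq_neg_of_add_eq_zero_left P_Am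
    have h1 : K s * P s * Am s = -(s⁻¹ • (Am s * (K s * P s))) := by
      rw [mul_assoc, hm, mul_neg, ← mul_assoc, K_Am, smul_mul_assoc, mul_assoc]
    have h2 : K s * P s * Ap s = -(s • (Ap s * (K s * P s))) := by
      rw [mul_assoc, hp, mul_neg, ← mul_assoc, K_Ap, smul_mul_assoc, mul_assoc]
    have hc1 : (Ap s * Kinv s) ⊗ₜ[ℂ] (K s * P s * Am s) +
        (Kinv s * Ap s) ⊗ₜ[ℂ] (Am s * (K s * P s)) = 0 := by
      rw [h1, Ap_Kinv, TensorProduct.tmul_neg, TensorProduct.tmul_smul, TensorProduct.smul_tmul',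
        smul_smul]
      by_cases hs : s = 0
      · have h0 : Kinv s * Ap s = 0 := by
          have h : K s * Ap s = 0 := by rw [K_Ap, hs, zero_smul]
          have h' : Ap s = 0 := by rw [← one_mul (Ap s), ← Kinv_K, mul_assoc, h, mul_zero]
          rw [h', mul_zero]
        simp [h0]
      · rw [inv_mul_cancel₀ hs, one_smul, neg_add_cancel]
    have hc2 : (Am s * Kinv s) ⊗ₜ[ℂ] (K s * P s * Ap s) +
        (Kinv s * Am s) ⊗ₜ[ℂ] (Ap s * (K s * P s)) = 0 := by
      rw [h2, Am_Kinv, TensorProduct.tmul_neg, TensorProduct.tmul_smul, TensorProduct.smul_tmul',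
        smul_smul]
      by_cases hs : s = 0
      · have h0 : Kinv s * Am s = 0 := by
          have h : K s * Am s = 0 := by rw [K_Am, hs, inv_zero, zero_smul]
          have h' : Am s = 0 := by rw [← one_mul (Am s), ← Kinv_K, mul_assoc, h, mul_zero]
          rw [h', mul_zero]
        simp [h0]
      · rw [mul_inv_cancel₀ hs, one_smul, neg_add_cancel]
    have key : (Ap s * Am s + Am s * Ap s) ⊗ₜ[ℂ] (K s * P s * (K s * P s)) +
        (Kinv s * Kinv s) ⊗ₜ[ℂ] (Ap s * Am s + Am s * Ap s) =
        (s - s⁻¹)⁻¹ • ((K s * K s) ⊗ₜ[ℂ] (K s * K s) - (Kinv s * Kinv s) ⊗ₜ[ℂ] (Kinv s * Kinv s)) := by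
      rw [Ap_Am, K_P_K_P, pow_two, pow_two, ← TensorProduct.smul_tmul', TensorProduct.tmul_smul,
        ← smul_add, TensorProduct.sub_tmul, TensorProduct.tmul_sub]
      congr 1
      abel
    rw [← key, TensorProduct.add_tmul, TensorProduct.tmul_add]
    rw [add_eq_zero_iff_eq_neg] at hc1 hc2
    rw [hc1, hc2]
    abel
  case P_Ap =>
    have hp : P s * Ap s = -(Ap s * P s) := eq_neg_of_add_eq_zero_left P_Ap
    rw [hp, P_Kinv, ← mul_assoc, P_K, TensorProduct.neg_tmul, TensorProduct.tmul_neg]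
    abel
  case P_Am =>
    have hm : P s * Am s = -(Am s * P s) := eq_neg_of_add_eq_zero_left P_Am
    rw [hm, P_Kinv, ← mul_assoc, P_K, TensorProduct.neg_tmul, TensorProduct.tmul_neg]
    abel
  case P_K => rw [P_K]
  case P_Kinv => rw [P_Kinv]
  case K_Kinv => rw [K_Kinv]; rfl
  case Kinv_K => rw [Kinv_K]; rfl
  case P_P => rw [P_P]; rfl

/-- The coproduct `Δ : osp_q(1|2) → osp_q(1|2) ⊗ osp_q(1|2)`, an algebra morphism for the ungraded
product `(a₁ ⊗ a₂)(b₁ ⊗ b₂) = a₁b₁ ⊗ a₂b₂`. -/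
def comul (s : ℂ) : Osp s →ₐ[ℂ] Osp s ⊗[ℂ] Osp s :=
  RingQuot.liftAlgHom ℂ ⟨FreeAlgebra.lift ℂ (comulGen s), fun _ _ h => comulGen_rel s h⟩

theorem comul_mk (s : ℂ) (g : Gen) : comul s (mk s (FreeAlgebra.ι ℂ g)) = comulGen s g := by
  have : comul s (mk s (FreeAlgebra.ι ℂ g)) =
      FreeAlgebra.lift ℂ (comulGen s) (FreeAlgebra.ι ℂ g) :=
    RingQuot.liftAlgHom_mkAlgHom_apply ℂ _ _ _
  rw [this, FreeAlgebra.lift_ι_apply]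

end Osp

/-! ## Tensor powers and the extension morphisms -/

section TensorPower

variable (U : Type) [Ring U] [Algebra ℂ U]

/-- The `n`-fold tensor power of an algebra, with the product
`(a₁ ⊗ ⋯ ⊗ aₙ)(b₁ ⊗ ⋯ ⊗ bₙ) = a₁b₁ ⊗ ⋯ ⊗ aₙbₙ`. -/
abbrev TPow (n : ℕ) : Type := PiTensorProduct ℂ (fun _ : Fin n => U)

variable {U}

theorem extend_update {V : Type} [One V] {k n : ℕ} [DecidableEq (Fin k)] (f : Fin k ↪ Fin n) (x : Fin k → V)
    (i : Fin k) (a : V) :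
    Function.extend f (Function.update x i a) 1 =
      Function.update (Function.extend f x 1) (f i) a := by
  ext p
  by_cases hp : ∃ j, f j = p
  · obtain ⟨j, rfl⟩ := hp
    rw [f.injective.extend_apply]
    by_cases hj : j = i
    · subst hj
      simp
    · rw [Function.update_of_ne hj, Function.update_of_ne (fun h => hj (f.injective h)),
        f.injective.extend_apply]
  · rw [Function.extend_apply' _ _ _ hp, Function.update_of_ne, Function.extend_apply' _ _ _ hp]
    rintro rfl
    exact hp ⟨i, rfl⟩

theorem extend_one {V : Type} [One V] {k n : ℕ} (f : Fin k ↪ Fin n) :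
    Function.extend f (1 : Fin k → V) 1 = 1 := by
  ext p
  by_cases hp : ∃ j, f j = p
  · obtain ⟨j, rfl⟩ := hp
    rw [f.injective.extend_apply]
    rfl
  · rw [Function.extend_apply' _ _ _ hp]

/-- The algebra morphism `U^{⊗k} → U^{⊗n}` which puts the `i`-th factor at the position `f i` and
the unit at all positions outside the range of `f`. -/
def insertOnes {k n : ℕ} (f : Fin k ↪ Fin n) : TPow U k →ₐ[ℂ] TPow U n :=
  PiTensorProduct.liftAlgHom
    { toFun := fun x => PiTensorProduct.tprod ℂ (Function.extend f x 1)
      map_update_add' := by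
        intro _ x i a b
        simp only [extend_update, MultilinearMap.map_update_add]
      map_update_smul' := by
        intro _ x i c a
        simp only [extend_update, MultilinearMap.map_update_smul] }
    (by
      change PiTensorProduct.tprod ℂ (Function.extend f 1 1) = 1
      rw [extend_one, PiTensorProduct.one_def])
    (by
      intro x y
      change PiTensorProduct.tprod ℂ (Function.extend f (x * y) 1) =
        PiTensorProduct.tprod ℂ (Function.extend f x 1) *
          PiTensorProduct.tprod ℂ (Function.extend f y 1)
      rw [PiTensorProduct.tprod_mul_tprod, ← Function.extend_mul, mul_one])

theorem insertOnes_tprod {k n : ℕ} (f : Fin k ↪ Fin n) (x : Fin k → U) :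
    insertOnes f (PiTensorProduct.tprod ℂ x) =
      PiTensorProduct.tprod ℂ (Function.extend f x 1) := by
  simp [insertOnes]

/-- The identification `U^{⊗(k+1)} → U^{⊗k} ⊗ U`,
`x₀ ⊗ ⋯ ⊗ x_k ↦ (x₀ ⊗ ⋯ ⊗ x_{k-1}) ⊗ x_k`. -/
def splitLast (k : ℕ) : TPow U (k + 1) →ₐ[ℂ] TPow U k ⊗[ℂ] U :=
  PiTensorProduct.liftAlgHom
    { toFun := fun x => PiTensorProduct.tprod ℂ (Fin.init x) ⊗ₜ x (Fin.last k)
      map_update_add' := by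
        intro inst x i a b
        obtain rfl : inst = instDecidableEqFin (k + 1) := Subsingleton.elim _ _
        refine Fin.lastCases ?_ (fun j a b => ?_) i a b
        · intro a b
          simp [TensorProduct.tmul_add]
        · have h (c : U) : Function.update x j.castSucc c (Fin.last k) = x (Fin.last k) :=
            Function.update_of_ne (Fin.castSucc_lt_last j).ne' _ _
          simp only [h, Fin.init_update_castSucc, MultilinearMap.map_update_add,
            TensorProduct.add_tmul]
      map_update_smul' := by
        intro inst x i c a
        obtain rfl : inst = instDecidableEqFin (k + 1) := Subsingleton.elim _ _
        refine Fin.lastCases ?_ (fun j a => ?_) i a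
        · intro a
          simp
        · have h (c : U) : Function.update x j.castSucc c (Fin.last k) = x (Fin.last k) :=
            Function.update_of_ne (Fin.castSucc_lt_last j).ne' _ _
          simp only [h, Fin.init_update_castSucc, MultilinearMap.map_update_smul,
            TensorProduct.smul_tmul'] }
    (by rfl)
    (by
      intro x y
      change PiTensorProduct.tprod ℂ (Fin.init x * Fin.init y) ⊗ₜ _ = _
      rw [← PiTensorProduct.tprod_mul_tprod]
      exact (Algebra.TensorProduct.tmul_mul_tmul _ _ _ _).symm)

theorem splitLast_tprod (k : ℕ) (x : Fin (k + 1) → U) :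
    splitLast (U := U) k (PiTensorProduct.tprod ℂ x) =
      PiTensorProduct.tprod ℂ (Fin.init x) ⊗ₜ x (Fin.last k) := by
  exact PiTensorProduct.lift.tprod _

/-- The inverse identification `U^{⊗k} ⊗ U → U^{⊗(k+1)}`,
`(x₀ ⊗ ⋯ ⊗ x_{k-1}) ⊗ a ↦ x₀ ⊗ ⋯ ⊗ x_{k-1} ⊗ a`. -/
def joinLast (k : ℕ) : TPow U k ⊗[ℂ] U →ₐ[ℂ] TPow U (k + 1) :=
  Algebra.TensorProduct.lift (insertOnes Fin.castSuccEmb)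
    (PiTensorProduct.singleAlgHom (A := fun _ : Fin (k + 1) => U) (Fin.last k)) (by
      intro x a
      induction x using PiTensorProduct.induction_on with
      | smul_tprod r x =>
        rw [map_smul, insertOnes_tprod]
        refine Commute.smul_left ?_ r
        refine Commute.tprod ?_
        ext p
        refine Fin.lastCases ?_ (fun j => ?_) p
        · have : Function.extend (Fin.castSuccEmb (n := k)) x 1 (Fin.last k) = 1 :=
            Function.extend_apply' _ _ _ (by simp)
          simp only [Pi.mul_apply, this, one_mul, mul_one]
        · simp
      | add x y hx hy =>
        rw [map_add]
        exact hx.add_left hy)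

theorem joinLast_tprod (k : ℕ) (x : Fin k → U) (a : U) :
    joinLast (U := U) k (PiTensorProduct.tprod ℂ x ⊗ₜ a) =
      PiTensorProduct.tprod ℂ (Fin.snoc (α := fun _ => U) x a) := by
  rw [joinLast, Algebra.TensorProduct.lift_tmul, insertOnes_tprod,
    PiTensorProduct.singleAlgHom_apply, PiTensorProduct.tprod_mul_tprod]
  congr 1
  ext p
  refine Fin.lastCases ?_ (fun j => ?_) p
  · simp
  · have : Function.extend (Fin.castSuccEmb (n := k)) x 1 j.castSucc = x j :=
      (Fin.castSuccEmb (n := k)).injective.extend_apply x 1 j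
    rw [Pi.mul_apply, this]
    simp

end TensorPower

open Osp

variable (s : ℂ)

/-- The extension morphism `1 ⊗ ⋯ ⊗ 1 ⊗ Δ : osp_q(1|2)^{⊗(k+1)} → osp_q(1|2)^{⊗(k+2)}`, with `k`
identity factors:
`U^{⊗(k+1)} ≅ U^{⊗k} ⊗ U → U^{⊗k} ⊗ (U ⊗ U) ≅ (U^{⊗k} ⊗ U) ⊗ U ≅ U^{⊗(k+1)} ⊗ U ≅ U^{⊗(k+2)}`. -/
def comulLast (k : ℕ) : TPow (Osp s) (k + 1) →ₐ[ℂ] TPow (Osp s) (k + 2) :=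
  (joinLast (k + 1)).comp <|
    (Algebra.TensorProduct.map (joinLast k) (AlgHom.id ℂ (Osp s))).comp <|
    (Algebra.TensorProduct.assoc ℂ ℂ ℂ (TPow (Osp s) k) (Osp s) (Osp s)).symm.toAlgHom.comp <|
    (Algebra.TensorProduct.map (AlgHom.id ℂ (TPow (Osp s) k)) (comul s)).comp <|
    splitLast k

/-- The composite `(1 ⊗ ⋯ ⊗ 1 ⊗ Δ) ⋯ (1 ⊗ Δ) Δ : osp_q(1|2) → osp_q(1|2)^{⊗(k+1)}` of `k`
extension morphisms. -/
def iterComul : (k : ℕ) → Osp s →ₐ[ℂ] TPow (Osp s) (k + 1)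
  | 0 => PiTensorProduct.singleAlgHom (A := fun _ : Fin 1 => Osp s) 0
  | k + 1 => (comulLast s k).comp (iterComul k)

/-- The position map `t ↦ i + t` (with the positions of the tensor factors numbered `1, …, n`, so
that position `p` is the element `p - 1` of `Fin n`), sending the positions of a
`(j - i + 1)`-fold tensor to the interval `[i; j]`. -/
def intervalEmb (n i j : ℕ) (h : 1 ≤ i ∧ i ≤ j ∧ j ≤ n) : Fin (j - i + 1) ↪ Fin n where
  toFun t := ⟨i - 1 + t, by omega⟩
  inj' a b hab := by
    simp only [Fin.mk.injEq] at hab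
    omega

/-- The element `Γ_{[i;j]} ∈ osp_q(1|2)^{⊗n}` attached to the set of consecutive integers
`[i; j] = {i, …, j} ⊆ {1, …, n}`:
`Γ_{[i;j]} = 1^{⊗(i-1)} ⊗ ((1 ⊗ ⋯ ⊗ 1 ⊗ Δ) ⋯ (1 ⊗ Δ) Δ)(Γ) ⊗ 1^{⊗(n-j)}`. -/
def Gam (n i j : ℕ) (h : 1 ≤ i ∧ i ≤ j ∧ j ≤ n) : TPow (Osp s) n :=
  insertOnes (intervalEmb n i j h) (iterComul s (j - i) (casimir s))

/-! ## Tridiagonal relations -/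

/-- Terwilliger's tridiagonal relations for a pair `A, A'` of elements of a complex algebra with
parameters `β, γ, γ', ρ, ρ'`; here `⁅X, Y⁆ = XY - YX`. -/
def TridiagonalRelations {R : Type} [Ring R] [Algebra ℂ R] (A A' : R) (β γ γ' ρ ρ' : ℂ) : Prop :=
  ⁅A, A ^ 2 * A' + A' * A ^ 2 - β • (A * A' * A) - γ • (A * A' + A' * A) - ρ • A'⁆ = 0 ∧
  ⁅A', A' ^ 2 * A + A * A' ^ 2 - β • (A' * A * A') - γ' • (A' * A + A * A') - ρ' • A⁆ = 0

end QBannaiIto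

end

/-! Write `A = (f ⋆ g)(Γ)` and `A* = (g ⋆ k)(Γ)`, where `⋆` is convolution along `Δ` and `f`, `g`,
`k` are morphisms with pairwise commuting images: `f` is supported on the positions `1, …, m - 1`,
`g` on `m`, `k` on `m + 1`. By coassociativity the iterated coproduct splits off its last factor
(`iterComul_succ`), so the n-fold statement reduces to `tridiagonalRelations_conv`.

For the first relation, put `T(M) = A²M + MA² - βAMA - M`. The `M` for which `A` commutes with
`T(M)` form a bimodule over the centralizer of `A`. By `comul_casimir`, `A*` is a combination of
products `g(u) k(v)` with `u` among `Γ`, `L = K⁻²P`, `A₊K⁻¹P` and `K⁻¹A₋P`. The image of `k`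
centralizes `A`, so only the elements `1 ⊗ u` matter, with `A` replaced by `Δ(Γ)`: - `1 ⊗ Γ` is
central. - For `1 ⊗ L`, two successive q-anticommutators with `Δ(Γ)` return `1 ⊗ L` modulo the
centralizer of `Δ(Γ)`, and this is a cubic relation for `T` (`commute_tridiag_KinvSqP`). - The other
two come from `1 ⊗ L` by commutators with `Δ(A±)` and multiplication by `Δ(K)`, all in the
centralizer of `Δ(Γ)` because `Γ` is central.

The second relation is the first one read backwards: the automorphism `flip` fixes `Γ` and reverses
`Δ`, hence exchanges the roles of `A` and `A*`. -/

noncomputable section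

namespace QBannaiIto

set_option linter.unusedSimpArgs false

namespace Osp

variable {s : ℂ}

/-! ## Normal ordering in `osp_q(1|2)` -/

theorem Kinv_Ap : Kinv s * Ap s = s⁻¹ • (Ap s * Kinv s) := by
  -- For `s = 0` the relation makes `K A₊` vanish, and `K` is invertible, so `A₊ = 0`. The
  -- commutation rules therefore hold for every `s`.
  by_cases hs : s = 0
  · have h : K s * Ap s = 0 := by rw [K_Ap, hs, zero_smul]
    have h' : Ap s = 0 := by rw [← one_mul (Ap s), ← Kinv_K, mul_assoc, h, mul_zero]
    simp [h']
  · rw [Ap_Kinv, smul_smul, inv_mul_cancel₀ hs, one_smul]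

theorem Kinv_Am : Kinv s * Am s = s • (Am s * Kinv s) := by
  by_cases hs : s = 0
  · have h : K s * Am s = 0 := by rw [K_Am, hs, inv_zero, zero_smul]
    have h' : Am s = 0 := by rw [← one_mul (Am s), ← Kinv_K, mul_assoc, h, mul_zero]
    simp [h']
  · rw [Am_Kinv, smul_smul, mul_inv_cancel₀ hs, one_smul]

theorem Am_Ap : Am s * Ap s =
    -(Ap s * Am s) + (s - s⁻¹)⁻¹ • (K s * K s - Kinv s * Kinv s) := by
  have h := Ap_Am (s := s)
  rw [pow_two, pow_two] at h
  rw [← h]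
  abel

theorem P_mul_Ap : P s * Ap s = -(Ap s * P s) := eq_neg_of_add_eq_zero_left P_Ap

theorem P_mul_Am : P s * Am s = -(Am s * P s) := eq_neg_of_add_eq_zero_left P_Am

theorem K_Ap_assoc (x : Osp s) : K s * (Ap s * x) = s • (Ap s * (K s * x)) := by
  rw [← mul_assoc, K_Ap, smul_mul_assoc, mul_assoc]

theorem K_Am_assoc (x : Osp s) : K s * (Am s * x) = s⁻¹ • (Am s * (K s * x)) := by
  rw [← mul_assoc, K_Am, smul_mul_assoc, mul_assoc]

theorem Kinv_Ap_assoc (x : Osp s) : Kinv s * (Ap s * x) = s⁻¹ • (Ap s * (Kinv s * x)) := by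
  rw [← mul_assoc, Kinv_Ap, smul_mul_assoc, mul_assoc]

theorem Kinv_Am_assoc (x : Osp s) : Kinv s * (Am s * x) = s • (Am s * (Kinv s * x)) := by
  rw [← mul_assoc, Kinv_Am, smul_mul_assoc, mul_assoc]

theorem Am_Ap_assoc (x : Osp s) : Am s * (Ap s * x) =
    -(Ap s * (Am s * x)) + (s - s⁻¹)⁻¹ • (K s * (K s * x) - Kinv s * (Kinv s * x)) := by
  rw [← mul_assoc, Am_Ap, add_mul, neg_mul, smul_mul_assoc, sub_mul]
  simp only [mul_assoc]

theorem P_Ap_assoc (x : Osp s) : P s * (Ap s * x) = -(Ap s * (P s * x)) := by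
  rw [← mul_assoc, P_mul_Ap, neg_mul, mul_assoc]

theorem P_Am_assoc (x : Osp s) : P s * (Am s * x) = -(Am s * (P s * x)) := by
  rw [← mul_assoc, P_mul_Am, neg_mul, mul_assoc]

theorem P_K_assoc (x : Osp s) : P s * (K s * x) = K s * (P s * x) := by
  rw [← mul_assoc, P_K, mul_assoc]

theorem P_Kinv_assoc (x : Osp s) : P s * (Kinv s * x) = Kinv s * (P s * x) := by
  rw [← mul_assoc, P_Kinv, mul_assoc]

theorem K_Kinv_assoc (x : Osp s) : K s * (Kinv s * x) = x := by
  rw [← mul_assoc, K_Kinv, one_mul]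

theorem Kinv_K_assoc (x : Osp s) : Kinv s * (K s * x) = x := by
  rw [← mul_assoc, Kinv_K, one_mul]

theorem P_P_assoc (x : Osp s) : P s * (P s * x) = x := by
  rw [← mul_assoc, P_P, one_mul]

/-- Algebra morphisms out of `osp_q(1|2)` agree as soon as they agree on the generators. -/
theorem algHom_ext {R : Type} [Ring R] [Algebra ℂ R] {f g : Osp s →ₐ[ℂ] R}
    (hAp : f (Ap s) = g (Ap s)) (hAm : f (Am s) = g (Am s)) (hK : f (K s) = g (K s))
    (hKinv : f (Kinv s) = g (Kinv s)) (hP : f (P s) = g (P s)) : f = g := by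
  apply RingQuot.ringQuot_ext'
  refine FreeAlgebra.hom_ext (funext fun i => ?_)
  cases i
  exacts [hAp, hAm, hK, hKinv, hP]

theorem mk_surjective : Function.Surjective (mk s) := RingQuot.mkAlgHom_surjective ℂ (Rel s)

/-- An element commuting with the generators is central. -/
theorem commute_of_generators {c : Osp s} (hAp : Commute c (Ap s)) (hAm : Commute c (Am s))
    (hK : Commute c (K s)) (hKinv : Commute c (Kinv s)) (hP : Commute c (P s)) (x : Osp s) :
    Commute c x := by
  obtain ⟨x, rfl⟩ := mk_surjective x
  induction x using FreeAlgebra.induction with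
  | grade0 r => rw [AlgHom.commutes]; exact (Algebra.commutes r c).symm
  | grade1 i => cases i; exacts [hAp, hAm, hK, hKinv, hP]
  | mul x y hx hy => rw [map_mul]; exact hx.mul_right hy
  | add x y hx hy => rw [map_add]; exact hx.add_right hy

end Osp

/-- Nondegeneracy of the square root `s` of the deformation parameter. -/
structure Generic (s : ℂ) : Prop where
  ne_zero : s ≠ 0
  sq_sub_one : s ^ 2 - 1 ≠ 0
  sq_add_one : s ^ 2 + 1 ≠ 0

namespace Generic

variable {s : ℂ} (h : Generic s)
include h

/-- The scalars of the relations and of `Γ` are rewritten with the denominators `s² ± 1`, known to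
be non-zero, so that coefficients can be compared by `field_simp`. -/
theorem sub_inv : (s - s⁻¹)⁻¹ = s * (s ^ 2 - 1)⁻¹ := by
  have := h.ne_zero
  have := h.sq_sub_one
  have : s - s⁻¹ = (s ^ 2 - 1) / s := by field_simp
  rw [this, inv_div, div_eq_mul_inv]

theorem sq_sub_inv : (s ^ 2 - (s ^ 2)⁻¹)⁻¹ = s ^ 2 * ((s ^ 2 - 1)⁻¹ * (s ^ 2 + 1)⁻¹) := by
  have := h.ne_zero
  have : s ^ 2 - (s ^ 2)⁻¹ = (s ^ 2 - 1) * (s ^ 2 + 1) / s ^ 2 := by field_simp; ring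
  rw [this, inv_div, div_eq_mul_inv, mul_inv]

end Generic

namespace Osp

variable {s : ℂ}

/-- The Casimir element is central. -/
theorem casimir_commute (h : Generic s) (x : Osp s) : Commute (casimir s) x := by
  have h0 := h.ne_zero
  have h1 := h.sq_sub_one
  have h2 := h.sq_add_one
  -- Both sides are brought to the normal order `A₊`, `A₋`, `K^{±1}`, `P`; after that only scalar
  -- coefficients are compared. The product identities below are proved in the same way.
  refine commute_of_generators ?_ ?_ ?_ ?_ ?_ x <;> unfold casimir Commute SemiconjBy <;>
    simp only [pow_two (K s), pow_two (Kinv s), mul_assoc, mul_add, add_mul, mul_sub, sub_mul,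
      mul_neg, neg_mul, smul_mul_assoc, mul_smul_comm, smul_add, smul_sub, smul_neg, smul_smul,
      neg_neg, neg_add, neg_sub,
      K_Ap, K_Am, Kinv_Ap, Kinv_Am, Am_Ap, P_mul_Ap, P_mul_Am, P_K, P_Kinv, K_Kinv, Kinv_K, P_P,
      K_Ap_assoc, K_Am_assoc, Kinv_Ap_assoc, Kinv_Am_assoc, Am_Ap_assoc, P_Ap_assoc, P_Am_assoc,
      P_K_assoc, P_Kinv_assoc, K_Kinv_assoc, Kinv_K_assoc, P_P_assoc, mul_one, h.sub_inv,
      h.sq_sub_inv] <;>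
    match_scalars <;> field_simp <;> ring

/-! ## Elements occurring in the coproduct of the Casimir element -/

def KsqP (s : ℂ) : Osp s := K s * K s * P s
def KinvSqP (s : ℂ) : Osp s := Kinv s * Kinv s * P s
def leftAp (s : ℂ) : Osp s := Ap s * Kinv s * P s
def leftAm (s : ℂ) : Osp s := -(Kinv s * Am s * P s)
def rightAm (s : ℂ) : Osp s := K s * Am s
def rightAp (s : ℂ) : Osp s := Ap s * K s

theorem KsqP_KinvSqP : KsqP s * KinvSqP s = 1 := by
  simp only [KsqP, KinvSqP, mul_assoc, P_Kinv_assoc, P_P, K_Kinv_assoc, mul_one, K_Kinv]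

theorem KinvSqP_KsqP : KinvSqP s * KsqP s = 1 := by
  simp only [KsqP, KinvSqP, mul_assoc, P_K_assoc, P_P, Kinv_K_assoc, mul_one, Kinv_K]

theorem KinvSqP_leftAp : KinvSqP s * leftAp s = -(s⁻¹ ^ 2 • (leftAp s * KinvSqP s)) := by
  simp only [KinvSqP, leftAp, mul_assoc, P_Ap_assoc, Kinv_Ap_assoc, mul_neg, mul_smul_comm,
    smul_smul, P_Kinv_assoc, P_P, pow_two]

theorem KinvSqP_leftAm (s : ℂ) : KinvSqP s * leftAm s = -(s ^ 2 • (leftAm s * KinvSqP s)) := by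
  simp only [KinvSqP, leftAm, mul_assoc, P_Am_assoc, Kinv_Am_assoc, Kinv_Am, mul_neg, neg_mul,
    mul_smul_comm, smul_mul_assoc, smul_smul, P_Kinv_assoc, P_P, pow_two, smul_neg, neg_neg]

theorem KinvSqP_rightAm : KinvSqP s * rightAm s = -(s ^ 2 • (rightAm s * KinvSqP s)) := by
  by_cases hs : s = 0
  · have h : K s * Am s = 0 := by rw [K_Am, hs, inv_zero, zero_smul]
    simp [rightAm, h]
  simp only [KinvSqP, rightAm, mul_assoc, mul_neg, neg_mul, smul_mul_assoc, mul_smul_comm,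
    smul_neg, smul_smul, neg_neg, K_Am, Kinv_Am, P_mul_Am, P_K, P_Kinv, K_Kinv, Kinv_K, P_P,
    K_Am_assoc, Kinv_Am_assoc, P_Am_assoc, P_K_assoc, P_Kinv_assoc, K_Kinv_assoc, Kinv_K_assoc]
  match_scalars
  field_simp

theorem KinvSqP_rightAp : KinvSqP s * rightAp s = -(s⁻¹ ^ 2 • (rightAp s * KinvSqP s)) := by
  simp only [KinvSqP, rightAp, mul_assoc, P_Ap_assoc, Kinv_Ap_assoc, mul_neg, neg_mul, P_K,
    Kinv_K_assoc, K_Kinv_assoc, mul_smul_comm, smul_smul, pow_two]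

section

variable (h : Generic s)
include h

/-- Solving the definition of `Γ` for `A₊A₋` turns a product of a raising and a lowering element
into a polynomial in `Γ` and `K^{∓2}P`. This and the next three identities evaluate the products
that arise when `Δ(Γ)` is multiplied by its own summands. -/
theorem leftAp_leftAm : leftAp s * leftAm s = (s ^ 2) • (-(casimir s * KinvSqP s) +
    (s ^ 2 - (s ^ 2)⁻¹)⁻¹ • (s⁻¹ • (1 : Osp s) - s • (KinvSqP s * KinvSqP s))) := by
  have h0 := h.ne_zero
  have h1 := h.sq_sub_one
  have h2 := h.sq_add_one
  simp only [leftAp, leftAm, casimir, KinvSqP, pow_two (K s), pow_two (Kinv s), mul_assoc, mul_add, add_mul, mul_sub, sub_mul,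
      mul_neg, neg_mul, smul_mul_assoc, mul_smul_comm, smul_add, smul_sub, smul_neg, smul_smul,
      neg_neg, neg_add, neg_sub,
      K_Ap, K_Am, Kinv_Ap, Kinv_Am, Am_Ap, P_mul_Ap, P_mul_Am, P_K, P_Kinv, K_Kinv, Kinv_K, P_P,
      K_Ap_assoc, K_Am_assoc, Kinv_Ap_assoc, Kinv_Am_assoc, Am_Ap_assoc, P_Ap_assoc, P_Am_assoc,
      P_K_assoc, P_Kinv_assoc, K_Kinv_assoc, Kinv_K_assoc, P_P_assoc, mul_one, h.sub_inv,
      h.sq_sub_inv]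
  match_scalars <;> field_simp <;> ring

theorem leftAm_leftAp : leftAm s * leftAp s = casimir s * KinvSqP s +
    (s ^ 2 - (s ^ 2)⁻¹)⁻¹ • (s • (1 : Osp s) - s⁻¹ • (KinvSqP s * KinvSqP s)) := by
  have h0 := h.ne_zero
  have h1 := h.sq_sub_one
  have h2 := h.sq_add_one
  simp only [leftAp, leftAm, casimir, KinvSqP, pow_two (K s), pow_two (Kinv s), mul_assoc, mul_add, add_mul, mul_sub, sub_mul,
      mul_neg, neg_mul, smul_mul_assoc, mul_smul_comm, smul_add, smul_sub, smul_neg, smul_smul,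
      neg_neg, neg_add, neg_sub,
      K_Ap, K_Am, Kinv_Ap, Kinv_Am, Am_Ap, P_mul_Ap, P_mul_Am, P_K, P_Kinv, K_Kinv, Kinv_K, P_P,
      K_Ap_assoc, K_Am_assoc, Kinv_Ap_assoc, Kinv_Am_assoc, Am_Ap_assoc, P_Ap_assoc, P_Am_assoc,
      P_K_assoc, P_Kinv_assoc, K_Kinv_assoc, Kinv_K_assoc, P_P_assoc, mul_one, h.sub_inv,
      h.sq_sub_inv]
  match_scalars <;> field_simp <;> ring

theorem rightAm_rightAp : rightAm s * rightAp s = casimir s * KsqP s +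
    (s ^ 2 - (s ^ 2)⁻¹)⁻¹ • (s • (KsqP s * KsqP s) - s⁻¹ • (1 : Osp s)) := by
  have h0 := h.ne_zero
  have h1 := h.sq_sub_one
  have h2 := h.sq_add_one
  simp only [rightAp, rightAm, casimir, KsqP, pow_two (K s), pow_two (Kinv s), mul_assoc, mul_add, add_mul, mul_sub, sub_mul,
      mul_neg, neg_mul, smul_mul_assoc, mul_smul_comm, smul_add, smul_sub, smul_neg, smul_smul,
      neg_neg, neg_add, neg_sub,
      K_Ap, K_Am, Kinv_Ap, Kinv_Am, Am_Ap, P_mul_Ap, P_mul_Am, P_K, P_Kinv, K_Kinv, Kinv_K, P_P,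
      K_Ap_assoc, K_Am_assoc, Kinv_Ap_assoc, Kinv_Am_assoc, Am_Ap_assoc, P_Ap_assoc, P_Am_assoc,
      P_K_assoc, P_Kinv_assoc, K_Kinv_assoc, Kinv_K_assoc, P_P_assoc, mul_one, h.sub_inv,
      h.sq_sub_inv]
  match_scalars <;> field_simp <;> ring

theorem rightAp_rightAm : rightAp s * rightAm s = (s ^ 2)⁻¹ • (-(casimir s * KsqP s) +
    (s ^ 2 - (s ^ 2)⁻¹)⁻¹ • (s⁻¹ • (KsqP s * KsqP s) - s • (1 : Osp s))) := by
  have h0 := h.ne_zero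
  have h1 := h.sq_sub_one
  have h2 := h.sq_add_one
  simp only [rightAp, rightAm, casimir, KsqP, pow_two (K s), pow_two (Kinv s), mul_assoc, mul_add, add_mul, mul_sub, sub_mul,
      mul_neg, neg_mul, smul_mul_assoc, mul_smul_comm, smul_add, smul_sub, smul_neg, smul_smul,
      neg_neg, neg_add, neg_sub,
      K_Ap, K_Am, Kinv_Ap, Kinv_Am, Am_Ap, P_mul_Ap, P_mul_Am, P_K, P_Kinv, K_Kinv, Kinv_K, P_P,
      K_Ap_assoc, K_Am_assoc, Kinv_Ap_assoc, Kinv_Am_assoc, Am_Ap_assoc, P_Ap_assoc, P_Am_assoc,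
      P_K_assoc, P_Kinv_assoc, K_Kinv_assoc, Kinv_K_assoc, P_P_assoc, mul_one, h.sub_inv,
      h.sq_sub_inv]
  match_scalars <;> field_simp <;> ring

end

end Osp

/-- The cubic expression `A² M + M A² - β A M A - M` of the tridiagonal relations. -/
def tridiag {R : Type} [Ring R] [Algebra ℂ R] (β : ℂ) (A M : R) : R :=
  A * A * M + M * (A * A) - β • (A * M * A) - M

/-! ### The cubic expression as a bimodule map over the centralizer of `A` -/

section tridiag

variable {R S : Type} [Ring R] [Algebra ℂ R] [Ring S] [Algebra ℂ S] {β : ℂ} {A : R}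

theorem tridiag_add (M N : R) : tridiag β A (M + N) = tridiag β A M + tridiag β A N := by
  simp only [tridiag, mul_add, add_mul, smul_add]
  abel

theorem tridiag_smul (r : ℂ) (M : R) : tridiag β A (r • M) = r • tridiag β A M := by
  simp only [tridiag, mul_smul_comm, smul_mul_assoc, smul_add, smul_sub]
  rw [smul_comm β r]

/-- An element of the centralizer of `A` slides through every factor `A`. With additivity, this
makes the `M` whose cubic expression commutes with `A` a bimodule over that centralizer. -/
theorem tridiag_mul_left {u : R} (hu : Commute A u) (M : R) :
    tridiag β A (u * M) = u * tridiag β A M := by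
  have h (x : R) : A * (u * x) = u * (A * x) := by rw [← mul_assoc, hu.eq, mul_assoc]
  simp only [tridiag, mul_add, mul_sub, mul_smul_comm, mul_assoc, h]

theorem tridiag_mul_right {u : R} (hu : Commute A u) (M : R) :
    tridiag β A (M * u) = tridiag β A M * u := by
  simp only [tridiag, add_mul, sub_mul, smul_mul_assoc, mul_assoc, ← hu.eq]
  simp only [← mul_assoc u A, ← hu.eq, mul_assoc]

theorem map_tridiag (φ : R →ₐ[ℂ] S) (M : R) :
    φ (tridiag β A M) = tridiag β (φ A) (φ M) := by
  simp only [tridiag, map_sub, map_add, map_mul, map_smul]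

theorem commute_tridiag_of_commute {M : R} (hM : Commute A M) :
    Commute A (tridiag β A M) := by
  -- The factor `M` is pulled out; what remains is the expression at `1`, a polynomial in `A`.
  rw [← mul_one M, tridiag_mul_left hM, tridiag]
  refine hM.mul_right ?_
  simp only [mul_one, one_mul]
  exact (((Commute.refl A).mul_right (Commute.refl A)).add_right
    ((Commute.refl A).mul_right (Commute.refl A))).sub_right
    (((Commute.refl A).mul_right (Commute.refl A)).smul_right β) |>.sub_right (Commute.one_right A)

theorem commute_tridiag_add {M N : R} (hM : Commute A (tridiag β A M))
    (hN : Commute A (tridiag β A N)) : Commute A (tridiag β A (M + N)) := by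
  rw [tridiag_add]; exact hM.add_right hN

theorem commute_tridiag_smul (r : ℂ) {M : R} (hM : Commute A (tridiag β A M)) :
    Commute A (tridiag β A (r • M)) := by
  rw [tridiag_smul]; exact hM.smul_right r

theorem commute_tridiag_mul_left {u M : R} (hu : Commute A u)
    (hM : Commute A (tridiag β A M)) : Commute A (tridiag β A (u * M)) := by
  rw [tridiag_mul_left hu]; exact hu.mul_right hM

theorem commute_tridiag_mul_right {u M : R} (hu : Commute A u)
    (hM : Commute A (tridiag β A M)) : Commute A (tridiag β A (M * u)) := by
  rw [tridiag_mul_right hu]; exact hM.mul_right hu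

end tridiag

/-! ### The coproduct of the Casimir element and its q-anticommutators -/

namespace Osp

variable {s : ℂ}

theorem comul_Ap : comul s (Ap s) = Ap s ⊗ₜ (K s * P s) + Kinv s ⊗ₜ Ap s := comul_mk s .Ap
theorem comul_Am : comul s (Am s) = Am s ⊗ₜ (K s * P s) + Kinv s ⊗ₜ Am s := comul_mk s .Am
theorem comul_K : comul s (K s) = K s ⊗ₜ K s := comul_mk s .K
theorem comul_Kinv : comul s (Kinv s) = Kinv s ⊗ₜ Kinv s := comul_mk s .Kinv
theorem comul_P : comul s (P s) = P s ⊗ₜ P s := comul_mk s .P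

theorem comul_KinvSqP : comul s (KinvSqP s) = KinvSqP s ⊗ₜ KinvSqP s := by
  simp only [KinvSqP, map_mul, comul_Kinv, comul_P, Algebra.TensorProduct.tmul_mul_tmul]

/-- The coproduct of the Casimir element. -/
theorem comul_casimir (h : Generic s) :
    comul s (casimir s) = casimir s ⊗ₜ KsqP s + KinvSqP s ⊗ₜ casimir s +
      (s * (s ^ 2 + 1)⁻¹) • (KinvSqP s ⊗ₜ KsqP s) + leftAp s ⊗ₜ rightAm s +
      leftAm s ⊗ₜ rightAp s := by
  have h0 := h.ne_zero
  have h1 := h.sq_sub_one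
  have h2 := h.sq_add_one
  -- The scalar `s / (s² + 1) = (s - s⁻¹) / (q - q⁻¹)` corrects for the two `K⁻²P ⊗ K²P` terms
  -- contained in `Γ ⊗ K²P` and `K⁻²P ⊗ Γ`.
  simp only [casimir, map_mul, map_add, map_neg, map_smul, map_sub, comul_Ap, comul_Am, comul_K,
    comul_Kinv, comul_P, pow_two (K s), pow_two (Kinv s), mul_add, add_mul, mul_sub, sub_mul, mul_neg,
    neg_mul, smul_mul_assoc, mul_smul_comm, Algebra.TensorProduct.tmul_mul_tmul, KsqP, KinvSqP,
    leftAp, leftAm, rightAm, rightAp, TensorProduct.add_tmul, TensorProduct.tmul_add,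
    TensorProduct.sub_tmul, TensorProduct.tmul_sub, TensorProduct.neg_tmul, TensorProduct.tmul_neg,
    ← TensorProduct.smul_tmul', TensorProduct.tmul_smul, smul_add, smul_sub, smul_neg, smul_smul,
    neg_neg, neg_add, neg_sub, mul_assoc,
    K_Ap, K_Am, Kinv_Ap, Kinv_Am, P_mul_Ap, P_mul_Am, P_K, P_Kinv, K_Kinv, Kinv_K, P_P,
    K_Ap_assoc, K_Am_assoc, Kinv_Ap_assoc, Kinv_Am_assoc, P_Ap_assoc, P_Am_assoc,
    P_K_assoc, P_Kinv_assoc, K_Kinv_assoc, Kinv_K_assoc, P_P_assoc, mul_one, h.sq_sub_inv]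
  match_scalars <;> field_simp <;> ring

theorem KinvSqP_rightAm_assoc (x : Osp s) :
    KinvSqP s * (rightAm s * x) = -(s ^ 2 • (rightAm s * (KinvSqP s * x))) := by
  rw [← mul_assoc, KinvSqP_rightAm, neg_mul, smul_mul_assoc, mul_assoc]

theorem KinvSqP_rightAp_assoc (x : Osp s) :
    KinvSqP s * (rightAp s * x) = -(s⁻¹ ^ 2 • (rightAp s * (KinvSqP s * x))) := by
  rw [← mul_assoc, KinvSqP_rightAp, neg_mul, smul_mul_assoc, mul_assoc]

theorem KsqP_rightAp (h : Generic s) : KsqP s * rightAp s = -(s ^ 2 • (rightAp s * KsqP s)) := by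
  have h0 := h.ne_zero
  have h1 : rightAp s = KsqP s * (KinvSqP s * rightAp s) := by
    rw [← mul_assoc, KsqP_KinvSqP, one_mul]
  rw [KinvSqP_rightAp, mul_neg, mul_smul_comm, ← mul_assoc] at h1
  conv_rhs => rw [h1]
  rw [neg_mul, smul_neg, neg_neg, smul_mul_assoc, smul_smul, mul_assoc, KinvSqP_KsqP, mul_one,
    ← mul_pow, mul_inv_cancel₀ h0, one_pow, one_smul]

theorem KsqP_rightAp_assoc (h : Generic s) (x : Osp s) :
    KsqP s * (rightAp s * x) = -(s ^ 2 • (rightAp s * (KsqP s * x))) := by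
  rw [← mul_assoc, KsqP_rightAp h, neg_mul, smul_mul_assoc, mul_assoc]

section

variable (h : Generic s)
include h

/-- The weights `s`, `s⁻¹` are those that cancel the `leftAp ⊗ rightAm` term, since `s - s⁻¹ · s² =
0`; the `leftAm ⊗ rightAp` term survives with factor `s - s⁻³`. The first group on the right
commutes with `Δ(Γ)`, so only the second has to be followed further. -/
theorem comul_casimir_qcomm_KinvSqP :
    s • (comul s (casimir s) * (1 ⊗ₜ KinvSqP s)) + s⁻¹ • ((1 ⊗ₜ KinvSqP s) * comul s (casimir s)) =
      (s + s⁻¹) • (casimir s ⊗ₜ 1 + KinvSqP s ⊗ₜ (casimir s * KinvSqP s)) +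
      (KinvSqP s ⊗ₜ 1 + (s - s⁻¹ ^ 3) • (leftAm s ⊗ₜ (rightAp s * KinvSqP s))) := by
  have h0 := h.ne_zero
  have h2 := h.sq_add_one
  simp only [comul_casimir h, mul_add, add_mul, smul_mul_assoc, mul_smul_comm,
    Algebra.TensorProduct.tmul_mul_tmul, mul_one, one_mul, KsqP_KinvSqP, KinvSqP_KsqP,
    KinvSqP_rightAm, KinvSqP_rightAp, ← (casimir_commute h _).eq, TensorProduct.tmul_neg,
    TensorProduct.tmul_smul]
  match_scalars <;> field_simp <;> ring

/-- A q-anticommutator of the surviving part with `Δ(Γ)`, in the other order, closes the cycle: `1 ⊗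
K⁻²P` reappears, up to elements commuting with `Δ(Γ)`. -/
theorem qcomm_comul_casimir :
    s • ((KinvSqP s ⊗ₜ 1 + (s - s⁻¹ ^ 3) • (leftAm s ⊗ₜ[ℂ] (rightAp s * KinvSqP s))) *
        comul s (casimir s)) +
      s⁻¹ • (comul s (casimir s) *
        (KinvSqP s ⊗ₜ 1 + (s - s⁻¹ ^ 3) • (leftAm s ⊗ₜ (rightAp s * KinvSqP s)))) =
      1 ⊗ₜ KinvSqP s +
        (s + s⁻¹) • (1 ⊗ₜ casimir s + (casimir s * KinvSqP s) ⊗ₜ KinvSqP s) := by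
  have h0 := h.ne_zero
  have h1 := h.sq_sub_one
  have h2 := h.sq_add_one
  have hc (x : Osp s) : x * casimir s = casimir s * x := (casimir_commute h x).eq.symm
  have hc' (x y : Osp s) : x * (casimir s * y) = casimir s * (x * y) := by
    rw [← mul_assoc, hc, mul_assoc]
  have e1 : rightAm s * (rightAp s * KinvSqP s) = casimir s +
      (s ^ 2 - (s ^ 2)⁻¹)⁻¹ • (s • KsqP s - s⁻¹ • KinvSqP s) := by
    rw [← mul_assoc, rightAm_rightAp h]
    simp only [add_mul, sub_mul, smul_mul_assoc, mul_assoc, KsqP_KinvSqP, mul_one, one_mul]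
  have e2 : rightAp s * (rightAm s * KinvSqP s) = (s ^ 2)⁻¹ • (-casimir s +
      (s ^ 2 - (s ^ 2)⁻¹)⁻¹ • (s⁻¹ • KsqP s - s • KinvSqP s)) := by
    rw [← mul_assoc, rightAp_rightAm h]
    simp only [add_mul, sub_mul, smul_mul_assoc, mul_assoc, KsqP_KinvSqP, mul_one, one_mul, neg_mul]
  simp only [comul_casimir h, mul_add, add_mul, smul_mul_assoc, mul_smul_comm,
    Algebra.TensorProduct.tmul_mul_tmul, mul_one, one_mul, mul_assoc, KsqP_KinvSqP, KinvSqP_KsqP,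
    KinvSqP_leftAp, KinvSqP_leftAm, KsqP_rightAp_assoc h, smul_neg, neg_mul, mul_neg,
    KinvSqP_rightAm, KinvSqP_rightAp, KinvSqP_rightAm_assoc, KinvSqP_rightAp_assoc, e1, e2]
  simp only [hc, hc', leftAp_leftAm h, leftAm_leftAp h, h.sq_sub_inv, TensorProduct.tmul_neg,
    TensorProduct.neg_tmul, TensorProduct.add_tmul, TensorProduct.tmul_add, TensorProduct.sub_tmul,
    TensorProduct.tmul_sub, TensorProduct.tmul_smul, ← TensorProduct.smul_tmul', smul_add, smul_sub,
    smul_neg, smul_smul, neg_neg]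
  match_scalars <;> field_simp <;> ring

end

end Osp

/-! ### The first relation in `osp_q(1|2) ⊗ osp_q(1|2)` -/

namespace Osp

variable {s : ℂ}

section

variable (h : Generic s)
include h

theorem casimir_tmul_one_commute (x : Osp s ⊗[ℂ] Osp s) : Commute (casimir s ⊗ₜ 1) x := by
  induction x with
  | zero => exact Commute.zero_right _
  | tmul a b =>
    simp only [Commute, SemiconjBy, Algebra.TensorProduct.tmul_mul_tmul, mul_one, one_mul,
      (casimir_commute h a).eq]
  | add x y hx hy => exact hx.add_right hy

theorem one_tmul_casimir_commute (x : Osp s ⊗[ℂ] Osp s) : Commute (1 ⊗ₜ casimir s) x := by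
  induction x with
  | zero => exact Commute.zero_right _
  | tmul a b =>
    simp only [Commute, SemiconjBy, Algebra.TensorProduct.tmul_mul_tmul, mul_one, one_mul,
      (casimir_commute h b).eq]
  | add x y hx hy => exact hx.add_right hy

theorem comul_casimir_commute (x : Osp s) : Commute (comul s (casimir s)) (comul s x) :=
  (casimir_commute h x).map (comul s)

theorem commute_tridiag_KinvSqP :
    Commute (comul s (casimir s))
      (tridiag (-(s ^ 2 + (s ^ 2)⁻¹)) (comul s (casimir s)) (1 ⊗ₜ KinvSqP s)) := by
  have h0 := h.ne_zero
  have hA := comul_casimir_commute h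
  have h1 := casimir_tmul_one_commute h (comul s (casimir s))
  have h2 := one_tmul_casimir_commute h (comul s (casimir s))
  have hLL := hA (KinvSqP s)
  rw [comul_KinvSqP] at hLL
  have e1 := comul_casimir_qcomm_KinvSqP h
  have e2 := qcomm_comul_casimir h
  generalize KinvSqP s ⊗ₜ[ℂ] (1 : Osp s) + (s - s⁻¹ ^ 3) • (leftAm s ⊗ₜ (rightAp s * KinvSqP s)) =
    C at e1 e2
  -- `Γ ⊗ 1` and `1 ⊗ Γ` are central, and `K⁻²P` is group-like, so `K⁻²P ⊗ K⁻²P` lies in the image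
  -- of `Δ`.
  have hN : Commute (comul s (casimir s))
      ((s + s⁻¹) • (casimir s ⊗ₜ 1 + KinvSqP s ⊗ₜ (casimir s * KinvSqP s))) := by
    have : KinvSqP s ⊗ₜ (casimir s * KinvSqP s) =
        (1 ⊗ₜ[ℂ] casimir s) * (KinvSqP s ⊗ₜ KinvSqP s) := by
      rw [Algebra.TensorProduct.tmul_mul_tmul, one_mul]
    rw [this]
    exact (h1.symm.add_right (h2.symm.mul_right hLL)).smul_right _
  have hN' : Commute (comul s (casimir s))
      ((s + s⁻¹) • (1 ⊗ₜ casimir s + (casimir s * KinvSqP s) ⊗ₜ KinvSqP s)) := by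
    have : (casimir s * KinvSqP s) ⊗ₜ KinvSqP s =
        (casimir s ⊗ₜ[ℂ] 1) * (KinvSqP s ⊗ₜ KinvSqP s) := by
      rw [Algebra.TensorProduct.tmul_mul_tmul, one_mul]
    rw [this]
    exact (h2.symm.add_right (h1.symm.mul_right hLL)).smul_right _
  generalize comul s (casimir s) = A at *
  generalize (s + s⁻¹) • (casimir s ⊗ₜ[ℂ] (1 : Osp s) + KinvSqP s ⊗ₜ (casimir s * KinvSqP s)) = N at *
  generalize (s + s⁻¹) • ((1 : Osp s) ⊗ₜ[ℂ] casimir s + (casimir s * KinvSqP s) ⊗ₜ KinvSqP s) = N' at *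
  generalize (1 : Osp s) ⊗ₜ[ℂ] KinvSqP s = M at *
  -- Eliminating `C` from the two q-anticommutator identities gives the cubic expression; the
  -- weights combine to `s² + s⁻² = -β`.
  have key : tridiag (-(s ^ 2 + (s ^ 2)⁻¹)) A M = N' + (s + s⁻¹) • (N * A) := by
    have e1' : C = s • (A * M) + s⁻¹ • (M * A) - N := by rw [e1]; abel
    have e2' : N' = s • (C * A) + s⁻¹ • (A * C) - M := by rw [e2]; abel
    rw [e2', e1']
    simp only [tridiag, mul_add, add_mul, mul_sub, sub_mul, mul_smul_comm, smul_mul_assoc,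
      ← mul_assoc, hN.eq]
    match_scalars <;> field_simp <;> ring
  rw [key]
  exact hN'.add_right ((hN.mul_right (Commute.refl A)).smul_right _)

/-- `1 ⊗ K⁻²P` commutes with the summand `A₊ ⊗ KP` of `Δ(A₊)`, so the commutator isolates the
summand `K⁻¹ ⊗ A₊`, and `Δ(K)` then clears the left factor. The scalar comes from `K⁻²P A₊ = -s⁻² A₊
K⁻²P`. -/
theorem leftAp_eq : (1 : Osp s) ⊗ₜ[ℂ] leftAp s = (1 + s⁻¹ ^ 2)⁻¹ •
    ((comul s (Ap s) * (1 ⊗ₜ KinvSqP s) - (1 ⊗ₜ KinvSqP s) * comul s (Ap s)) * comul s (K s)) := by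
  have h0 := h.ne_zero
  have h2 := h.sq_add_one
  have h3 : (1 + s⁻¹ ^ 2)⁻¹ = s ^ 2 * (s ^ 2 + 1)⁻¹ := by
    have : 1 + s⁻¹ ^ 2 = (s ^ 2 + 1) / s ^ 2 := by field_simp
    rw [this, inv_div, div_eq_mul_inv]
  simp only [comul_Ap, comul_K, KinvSqP, leftAp, add_mul, mul_add, sub_mul,
    Algebra.TensorProduct.tmul_mul_tmul, one_mul, mul_one, mul_assoc, P_Ap_assoc, P_mul_Ap, P_K,
    P_Kinv, P_K_assoc, P_Kinv_assoc, K_Kinv_assoc, Kinv_K_assoc, K_Kinv, Kinv_K, P_P, P_P_assoc,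
    Kinv_Ap_assoc, mul_neg, neg_mul, mul_smul_comm, smul_mul_assoc, TensorProduct.tmul_neg,
    TensorProduct.tmul_smul, smul_smul, h3]
  match_scalars <;> field_simp <;> ring

theorem leftAm_eq : (1 : Osp s) ⊗ₜ[ℂ] leftAm s = (-(s * (1 + s ^ 2)⁻¹)) •
    ((comul s (Am s) * (1 ⊗ₜ KinvSqP s) - (1 ⊗ₜ KinvSqP s) * comul s (Am s)) * comul s (K s)) := by
  have h0 := h.ne_zero
  have h2 := h.sq_add_one
  rw [add_comm] at h2
  simp only [comul_Am, comul_K, KinvSqP, leftAm, add_mul, mul_add, sub_mul,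
    Algebra.TensorProduct.tmul_mul_tmul, one_mul, mul_one, mul_assoc, P_Am_assoc, P_mul_Am, P_K,
    P_Kinv, P_K_assoc, P_Kinv_assoc, K_Kinv_assoc, Kinv_K_assoc, K_Kinv, Kinv_K, P_P, P_P_assoc,
    Kinv_Am_assoc, mul_neg, neg_mul, mul_smul_comm, smul_mul_assoc, TensorProduct.tmul_neg,
    TensorProduct.tmul_smul, smul_smul]
  match_scalars <;> field_simp <;> ring

theorem commute_tridiag_comm_mul (x y : Osp s) (r : ℂ) :
    Commute (comul s (casimir s)) (tridiag (-(s ^ 2 + (s ^ 2)⁻¹)) (comul s (casimir s))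
      (r • ((comul s x * (1 ⊗ₜ KinvSqP s) - (1 ⊗ₜ KinvSqP s) * comul s x) * comul s y))) := by
  have hL := commute_tridiag_KinvSqP h
  have hx := comul_casimir_commute h x
  rw [sub_eq_add_neg, ← neg_one_smul ℂ (_ * comul s x)]
  exact commute_tridiag_smul _ (commute_tridiag_mul_right (comul_casimir_commute h y)
    (commute_tridiag_add (commute_tridiag_mul_left hx hL)
      (commute_tridiag_smul _ (commute_tridiag_mul_right hx hL))))

end

/-! ## Convolution of commuting morphisms -/

section conv

variable {R : Type} [Ring R] [Algebra ℂ R]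

/-- The convolution `a ↦ f(a₍₁₎) g(a₍₂₎)` of two morphisms with commuting images. -/
def conv (f g : Osp s →ₐ[ℂ] R) (hfg : ∀ x y, Commute (f x) (g y)) : Osp s →ₐ[ℂ] R :=
  (Algebra.TensorProduct.lift f g hfg).comp (comul s)

variable {f g k : Osp s →ₐ[ℂ] R} (hfg : ∀ x y, Commute (f x) (g y))

theorem conv_congr {f' g' : Osp s →ₐ[ℂ] R} (hf : f = f') (hg : g = g')
    (hfg' : ∀ x y, Commute (f' x) (g' y)) : conv f g hfg = conv f' g' hfg' := by
  subst hf hg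
  rfl

theorem conv_Ap : conv f g hfg (Ap s) = f (Ap s) * (g (K s) * g (P s)) + f (Kinv s) * g (Ap s) := by
  simp [conv, comul_Ap]

theorem conv_Am : conv f g hfg (Am s) = f (Am s) * (g (K s) * g (P s)) + f (Kinv s) * g (Am s) := by
  simp [conv, comul_Am]

theorem conv_K : conv f g hfg (K s) = f (K s) * g (K s) := by
  simp [conv, comul_K]

theorem conv_Kinv : conv f g hfg (Kinv s) = f (Kinv s) * g (Kinv s) := by
  simp [conv, comul_Kinv]

theorem conv_P : conv f g hfg (P s) = f (P s) * g (P s) := by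
  simp [conv, comul_P]

theorem conv_commute (hfk : ∀ x y, Commute (f x) (k y)) (hgk : ∀ x y, Commute (g x) (k y))
    (x y : Osp s) : Commute (conv f g hfg x) (k y) := by
  have (z : Osp s ⊗[ℂ] Osp s) : Commute (Algebra.TensorProduct.lift f g hfg z) (k y) := by
    induction z with
    | zero => rw [map_zero]; exact Commute.zero_left _
    | tmul a b => rw [Algebra.TensorProduct.lift_tmul]; exact (hfk a y).mul_left (hgk b y)
    | add z w hz hw => rw [map_add]; exact hz.add_left hw
  exact this _

/-- Coassociativity of `Δ`, checked on the generators. -/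
theorem conv_assoc (hfk : ∀ x y, Commute (f x) (k y)) (hgk : ∀ x y, Commute (g x) (k y)) :
    conv (conv f g hfg) k (conv_commute hfg hfk hgk) =
      conv f (conv g k hgk) fun x y =>
        (conv_commute hgk (fun a b => (hfg b a).symm) (fun a b => (hfk b a).symm) y x).symm := by
  apply algHom_ext <;>
    simp only [conv_Ap, conv_Am, conv_K, conv_Kinv, conv_P, mul_add, add_mul, mul_assoc, add_assoc]
  all_goals
    congr 1
    simp only [← mul_assoc (g (P s)), (hgk (P s) (K s)).eq, mul_assoc]

theorem comp_conv {S : Type} [Ring S] [Algebra ℂ S] (φ : R →ₐ[ℂ] S)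
    (hφ : ∀ x y, Commute (φ.comp f x) (φ.comp g y)) :
    φ.comp (conv f g hfg) = conv (φ.comp f) (φ.comp g) hφ := by
  apply algHom_ext <;>
    simp only [AlgHom.comp_apply, conv_Ap, conv_Am, conv_K, conv_Kinv, conv_P, map_mul, map_add]

/-- Convolutions `f ⋆ g` and `g ⋆ k` at the Casimir element satisfy the first tridiagonal
relation. -/
theorem commute_tridiag_conv (h : Generic s) (hfk : ∀ x y, Commute (f x) (k y))
    (hgk : ∀ x y, Commute (g x) (k y)) :
    Commute (conv f g hfg (casimir s)) (tridiag (-(s ^ 2 + (s ^ 2)⁻¹))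
      (conv f g hfg (casimir s)) (conv g k hgk (casimir s))) := by
  have hk (y : Osp s) : Commute (conv f g hfg (casimir s)) (k y) := conv_commute hfg hfk hgk _ y
  -- The morphism `a ⊗ b ↦ f(a) g(b)` carries `Δ(Γ)` to `A` and `1 ⊗ M` to `g(M)`, so it transports
  -- the universal relation to `R`.
  have push {M : Osp s} (hM : Commute (comul s (casimir s))
      (tridiag (-(s ^ 2 + (s ^ 2)⁻¹)) (comul s (casimir s)) (1 ⊗ₜ M))) :
      Commute (conv f g hfg (casimir s))
        (tridiag (-(s ^ 2 + (s ^ 2)⁻¹)) (conv f g hfg (casimir s)) (g M)) := by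
    have := hM.map (Algebra.TensorProduct.lift f g hfg)
    rwa [map_tridiag, Algebra.TensorProduct.lift_tmul, map_one, one_mul] at this
  have hG := push (commute_tridiag_of_commute (one_tmul_casimir_commute h _).symm)
  have hL := push (commute_tridiag_KinvSqP h)
  have hX := push (M := leftAp s) (by rw [leftAp_eq h]; exact commute_tridiag_comm_mul h _ _ _)
  have hZ := push (M := leftAm s) (by rw [leftAm_eq h]; exact commute_tridiag_comm_mul h _ _ _)
  have e : conv g k hgk (casimir s) = g (casimir s) * k (KsqP s) + g (KinvSqP s) * k (casimir s) +
      (s * (s ^ 2 + 1)⁻¹) • (g (KinvSqP s) * k (KsqP s)) + g (leftAp s) * k (rightAm s) +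
      g (leftAm s) * k (rightAp s) := by
    rw [conv, AlgHom.comp_apply, comul_casimir h]
    simp only [map_add, map_smul, Algebra.TensorProduct.lift_tmul]
  rw [e]
  refine commute_tridiag_add (commute_tridiag_add (commute_tridiag_add (commute_tridiag_add
    ?_ ?_) (commute_tridiag_smul _ ?_)) ?_) ?_
  exacts [commute_tridiag_mul_right (hk _) hG, commute_tridiag_mul_right (hk _) hL,
    commute_tridiag_mul_right (hk _) hL, commute_tridiag_mul_right (hk _) hX,
    commute_tridiag_mul_right (hk _) hZ]

end conv

/-! ## The flip automorphism -/

/-- Images of the generators under `A₊ ↦ A₋P`, `A₋ ↦ A₊P`, `K ↔ K⁻¹`, `P ↦ P`. -/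
def flipGen (s : ℂ) : Gen → Osp s
  | .Ap => Am s * P s
  | .Am => Ap s * P s
  | .K => Kinv s
  | .Kinv => K s
  | .P => P s

theorem flipGen_rel (s : ℂ) {x y : FreeAlgebra ℂ Gen} (h : Rel s x y) :
    FreeAlgebra.lift ℂ (flipGen s) x = FreeAlgebra.lift ℂ (flipGen s) y := by
  cases h <;> simp only [map_mul, map_add, map_smul, map_sub, map_one, map_zero,
    FreeAlgebra.lift_ι_apply, flipGen, pow_two, mul_assoc, P_K, P_Kinv, P_P, P_mul_Ap, P_mul_Am,
    Kinv_Ap_assoc, Kinv_Am_assoc, P_Ap_assoc, P_Am_assoc, P_K_assoc, P_Kinv_assoc, K_Kinv, Kinv_K,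
    Kinv_K_assoc, mul_neg, mul_one, neg_add_cancel, Am_Ap]
  module

/-- The automorphism `A₊ ↦ A₋P`, `A₋ ↦ A₊P`, `K ↔ K⁻¹`, `P ↦ P`, which reverses the
coproduct. -/
def flip (s : ℂ) : Osp s →ₐ[ℂ] Osp s :=
  RingQuot.liftAlgHom ℂ ⟨FreeAlgebra.lift ℂ (flipGen s), fun _ _ h => flipGen_rel s h⟩

theorem flip_mk (s : ℂ) (i : Gen) : flip s (mk s (FreeAlgebra.ι ℂ i)) = flipGen s i := by
  have : flip s (mk s (FreeAlgebra.ι ℂ i)) = FreeAlgebra.lift ℂ (flipGen s) (FreeAlgebra.ι ℂ i) :=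
    RingQuot.liftAlgHom_mkAlgHom_apply ℂ _ _ _
  rw [this, FreeAlgebra.lift_ι_apply]

theorem flip_Ap : flip s (Ap s) = Am s * P s := flip_mk s .Ap
theorem flip_Am : flip s (Am s) = Ap s * P s := flip_mk s .Am
theorem flip_K : flip s (K s) = Kinv s := flip_mk s .K
theorem flip_Kinv : flip s (Kinv s) = K s := flip_mk s .Kinv
theorem flip_P : flip s (P s) = P s := flip_mk s .P

theorem flip_casimir (h : Generic s) : flip s (casimir s) = casimir s := by
  have h0 := h.ne_zero
  have h1 := h.sq_sub_one
  have h2 := h.sq_add_one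
  simp only [casimir, map_mul, map_add, map_neg, map_smul, map_sub, map_pow, flip_Ap, flip_Am,
    flip_K, flip_Kinv, flip_P, pow_two (K s), pow_two (Kinv s), mul_assoc, P_Ap_assoc, P_P,
    mul_neg, neg_neg, mul_one, Am_Ap, h.sub_inv, h.sq_sub_inv, add_mul, sub_mul, neg_mul,
    smul_mul_assoc, smul_sub, smul_smul, Am_Ap_assoc, P_mul_Ap, neg_add]
  match_scalars <;> field_simp <;> ring

/-- Swapping the two morphisms and twisting both by `flip` amounts to twisting their convolution;
this is how `flip` reverses the coproduct. -/
theorem conv_flip {R : Type} [Ring R] [Algebra ℂ R] {f g : Osp s →ₐ[ℂ] R}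
    (hfg : ∀ x y, Commute (f x) (g y))
    (hgf : ∀ x y, Commute (g.comp (flip s) x) (f.comp (flip s) y)) :
    conv (g.comp (flip s)) (f.comp (flip s)) hgf = (conv f g hfg).comp (flip s) := by
  have e (x y : Osp s) : g x * f y = f y * g x := (hfg y x).eq.symm
  have e' (x y : Osp s) (z : R) : g x * (f y * z) = f y * (g x * z) := by
    rw [← mul_assoc, e, mul_assoc]
  have eP : g (P s) * g (P s) = 1 := by rw [← map_mul, P_P, map_one]
  apply algHom_ext <;>
    simp only [AlgHom.comp_apply, conv_Ap, conv_Am, conv_K, conv_Kinv, conv_P, flip_Ap, flip_Am,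
      flip_K, flip_Kinv, flip_P, map_mul, add_mul, mul_assoc, e, e', eP, mul_one, add_comm]

/-- The convolutions `f ⋆ g` and `g ⋆ k` at the Casimir element satisfy the tridiagonal
relations. -/
theorem tridiagonalRelations_conv {R : Type} [Ring R] [Algebra ℂ R] (h : Generic s)
    {f g k : Osp s →ₐ[ℂ] R} (hfg : ∀ x y, Commute (f x) (g y))
    (hfk : ∀ x y, Commute (f x) (k y)) (hgk : ∀ x y, Commute (g x) (k y)) :
    TridiagonalRelations (conv f g hfg (casimir s)) (conv g k hgk (casimir s))
      (-(s ^ 2 + (s ^ 2)⁻¹)) 0 0 1 1 := by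
  have h1 := commute_tridiag_conv hfg h hfk hgk
  have hkg' : ∀ x y, Commute (k.comp (flip s) x) (g.comp (flip s) y) := fun x y => (hgk _ _).symm
  have hgf' : ∀ x y, Commute (g.comp (flip s) x) (f.comp (flip s) y) := fun x y => (hfg _ _).symm
  have hkf' : ∀ x y, Commute (k.comp (flip s) x) (f.comp (flip s) y) := fun x y => (hfk _ _).symm
  -- The triple `(f, g, k)` is replaced by `(k, g, f)` twisted by `flip`; as `flip` fixes `Γ`, this
  -- exchanges `A` and `A*`.
  have h2 := commute_tridiag_conv hkg' h hkf' hgf'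
  rw [conv_flip hgk, conv_flip hfg, AlgHom.comp_apply, AlgHom.comp_apply, flip_casimir h] at h2
  constructor
  · rw [← h1.lie_eq]
    simp only [tridiag, pow_two, zero_smul, sub_zero, one_smul]
  · rw [← h2.lie_eq]
    simp only [tridiag, pow_two, zero_smul, sub_zero, one_smul]

end Osp

/-! ### Insertion of tensors with disjoint supports -/

section TensorPower

variable {U : Type} [Ring U] [Algebra ℂ U]

/-- The morphism which puts an element at the position `i` and the unit elsewhere. -/
abbrev single {n : ℕ} (i : Fin n) : U →ₐ[ℂ] TPow U n :=
  PiTensorProduct.singleAlgHom (A := fun _ : Fin n => U) i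

theorem single_apply {n : ℕ} (i : Fin n) (a : U) :
    single i a = PiTensorProduct.tprod ℂ (Function.update (1 : Fin n → U) i a) :=
  PiTensorProduct.singleAlgHom_apply _ _

theorem tpow_algHom_ext {n : ℕ} {S : Type} [Ring S] [Algebra ℂ S] {φ ψ : TPow U n →ₐ[ℂ] S}
    (h : ∀ x, φ (PiTensorProduct.tprod ℂ x) = ψ (PiTensorProduct.tprod ℂ x)) : φ = ψ := by
  refine AlgHom.ext fun z => ?_
  induction z using PiTensorProduct.induction_on with
  | smul_tprod r x => rw [map_smul, map_smul, h]
  | add x y hx hy => rw [map_add, map_add, hx, hy]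

theorem insertOnes_comp {k l n : ℕ} (g : Fin k ↪ Fin l) (f : Fin l ↪ Fin n) :
    (insertOnes f).comp (insertOnes g) = insertOnes (U := U) (g.trans f) := by
  refine tpow_algHom_ext fun x => ?_
  rw [AlgHom.comp_apply, insertOnes_tprod, insertOnes_tprod, insertOnes_tprod]
  congr 1
  ext p
  by_cases hp : ∃ j, f j = p
  · obtain ⟨j, rfl⟩ := hp
    rw [f.injective.extend_apply]
    by_cases hj : ∃ i, g i = j
    · obtain ⟨i, rfl⟩ := hj
      rw [g.injective.extend_apply]
      exact ((g.trans f).injective.extend_apply x 1 i).symm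
    · rw [Function.extend_apply' _ _ _ hj, Function.extend_apply']
      · rfl
      · rintro ⟨i, hi⟩
        exact hj ⟨i, f.injective hi⟩
  · rw [Function.extend_apply' _ _ _ hp, Function.extend_apply']
    rintro ⟨i, hi⟩
    exact hp ⟨g i, hi⟩

theorem insertOnes_comp_single {k n : ℕ} (f : Fin k ↪ Fin n) (i : Fin k) :
    (insertOnes f).comp (single i) = single (U := U) (f i) := by
  ext a
  rw [AlgHom.comp_apply, single_apply, single_apply, insertOnes_tprod, extend_update, extend_one]

theorem insertOnes_commute_single {k n : ℕ} (f : Fin k ↪ Fin n) {i : Fin n} (hi : ∀ j, f j ≠ i)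
    (x : TPow U k) (a : U) : Commute (insertOnes f x) (single i a) := by
  induction x using PiTensorProduct.induction_on with
  | smul_tprod r x =>
    rw [map_smul, insertOnes_tprod, single_apply]
    refine Commute.smul_left (Commute.tprod ?_) r
    ext p
    rw [Pi.mul_apply, Pi.mul_apply]
    by_cases hp : p = i
    · subst hp
      rw [Function.extend_apply' _ _ _ (by rintro ⟨j, hj⟩; exact hi j hj)]
      simp
    · rw [Function.update_of_ne hp]
      simp
  | add x y hx hy => rw [map_add]; exact hx.add_left hy

theorem single_commute_single {n : ℕ} {i j : Fin n} (hij : i ≠ j) (a b : U) :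
    Commute (single i a) (single j b) := by
  have := insertOnes_commute_single (U := U) (k := 1) (n := n)
    ⟨fun _ => i, fun _ _ _ => Subsingleton.elim _ _⟩ (i := j) (fun _ => hij) (single 0 a) b
  rwa [← AlgHom.comp_apply, insertOnes_comp_single] at this

theorem splitLast_insertOnes (k : ℕ) (y : TPow U k) :
    splitLast (U := U) k (insertOnes Fin.castSuccEmb y) = y ⊗ₜ 1 := by
  have : (splitLast (U := U) k).comp (insertOnes Fin.castSuccEmb) =
      (Algebra.TensorProduct.includeLeft : TPow U k →ₐ[ℂ] TPow U k ⊗[ℂ] U) := by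
    refine tpow_algHom_ext fun x => ?_
    rw [AlgHom.comp_apply, insertOnes_tprod, splitLast_tprod,
      Algebra.TensorProduct.includeLeft_apply]
    congr 1
    · congr 1
      ext p
      exact (Fin.castSuccEmb (n := k)).injective.extend_apply x 1 p
    · exact Function.extend_apply' _ _ _ (by simp)
  exact DFunLike.congr_fun this y

theorem splitLast_single (k : ℕ) (a : U) :
    splitLast (U := U) k (single (Fin.last k) a) = 1 ⊗ₜ a := by
  rw [single_apply, splitLast_tprod, Function.update_self, PiTensorProduct.one_def]
  congr 2
  ext p
  exact Function.update_of_ne (Fin.castSucc_lt_last p).ne _ _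

theorem joinLast_tmul (k : ℕ) (y : TPow U k) (a : U) :
    joinLast (U := U) k (y ⊗ₜ a) = insertOnes Fin.castSuccEmb y * single (Fin.last k) a :=
  Algebra.TensorProduct.lift_tmul _ _ _ _ _

end TensorPower

/-! ### Iterated coproducts as convolutions -/

variable {s : ℂ}

open Osp

theorem comulLast_comp_insertOnes (k : ℕ) :
    (comulLast s k).comp (insertOnes Fin.castSuccEmb) =
      (insertOnes Fin.castSuccEmb).comp (insertOnes Fin.castSuccEmb) := by
  refine AlgHom.ext fun y => ?_
  simp only [comulLast, AlgHom.comp_apply, splitLast_insertOnes, Algebra.TensorProduct.map_tmul,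
    map_one, AlgHom.id_apply]
  change joinLast (U := Osp s) (k + 1) (Algebra.TensorProduct.map (joinLast k) (AlgHom.id ℂ (Osp s))
    ((Algebra.TensorProduct.assoc ℂ ℂ ℂ (TPow (Osp s) k) (Osp s) (Osp s)).symm
      (y ⊗ₜ (1 ⊗ₜ 1)))) = _
  rw [Algebra.TensorProduct.assoc_symm_tmul, Algebra.TensorProduct.map_tmul, joinLast_tmul,
    AlgHom.id_apply, map_one, joinLast_tmul, map_one, mul_one, mul_one]

theorem comulLast_comp_single (k : ℕ)
    (hc : ∀ x y, Commute (single (U := Osp s) (Fin.last k).castSucc x) (single (Fin.last (k + 1)) y)) :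
    (comulLast s k).comp (single (Fin.last k)) =
      conv (single (Fin.last k).castSucc) (single (Fin.last (k + 1))) hc := by
  ext a
  simp only [comulLast, AlgHom.comp_apply, conv]
  rw [splitLast_single, Algebra.TensorProduct.map_tmul, map_one]
  generalize comul s a = z
  change joinLast (U := Osp s) (k + 1) (Algebra.TensorProduct.map (joinLast k) (AlgHom.id ℂ (Osp s))
    ((Algebra.TensorProduct.assoc ℂ ℂ ℂ (TPow (Osp s) k) (Osp s) (Osp s)).symm
      (1 ⊗ₜ z))) = _
  induction z with
  | zero => simp only [TensorProduct.tmul_zero, map_zero]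
  | tmul a b =>
    rw [Algebra.TensorProduct.assoc_symm_tmul, Algebra.TensorProduct.map_tmul, joinLast_tmul,
      AlgHom.id_apply, joinLast_tmul, map_one, one_mul, Algebra.TensorProduct.lift_tmul,
      ← AlgHom.comp_apply, insertOnes_comp_single]
    rfl
  | add x y hx hy => rw [TensorProduct.tmul_add, map_add, map_add, map_add, hx, hy, map_add]

theorem insertOnes_castSucc_commute (k : ℕ) (x : TPow (Osp s) k) (a : Osp s) :
    Commute (insertOnes Fin.castSuccEmb x) (single (Fin.last k) a) :=
  insertOnes_commute_single _ (fun j => (Fin.castSucc_lt_last j).ne) x a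

/-- The iterated coproduct splits off its last factor by a single coproduct. -/
theorem iterComul_succ (k : ℕ)
    (hc : ∀ x y, Commute ((insertOnes Fin.castSuccEmb).comp (iterComul s k) x)
      (single (Fin.last (k + 1)) y)) :
    iterComul s (k + 1) =
      conv ((insertOnes Fin.castSuccEmb).comp (iterComul s k)) (single (Fin.last (k + 1))) hc := by
  induction k with
  | zero =>
    have hc' : ∀ x y, Commute (single (U := Osp s) (Fin.last 0).castSucc x)
        (single (Fin.last 1) y) := single_commute_single (Fin.castSucc_lt_last _).ne
    exact (comulLast_comp_single 0 hc').trans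
      (conv_congr _ (insertOnes_comp_single Fin.castSuccEmb (Fin.last 0)).symm rfl _)
  | succ k ih =>
    have hF : ∀ x y, Commute ((insertOnes Fin.castSuccEmb).comp (iterComul s k) x)
      (single (Fin.last (k + 1)) y) := fun x y => insertOnes_castSucc_commute _ _ _
    let F : Osp s →ₐ[ℂ] TPow (Osp s) (k + 3) :=
      (insertOnes Fin.castSuccEmb).comp ((insertOnes Fin.castSuccEmb).comp (iterComul s k))
    let S : Osp s →ₐ[ℂ] TPow (Osp s) (k + 3) := single (Fin.last (k + 1)).castSucc
    let T : Osp s →ₐ[ℂ] TPow (Osp s) (k + 3) := single (Fin.last (k + 2))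
    have eF : (comulLast s (k + 1)).comp ((insertOnes Fin.castSuccEmb).comp (iterComul s k)) = F := by
      rw [← AlgHom.comp_assoc, comulLast_comp_insertOnes, AlgHom.comp_assoc]
    have eS : (insertOnes Fin.castSuccEmb).comp (single (Fin.last (k + 1))) = S :=
      insertOnes_comp_single _ _
    have hST : ∀ x y, Commute (S x) (T y) := single_commute_single (Fin.castSucc_lt_last _).ne
    have hFT : ∀ x y, Commute (F x) (T y) := fun x y => insertOnes_castSucc_commute _ _ _
    have hFS : ∀ x y, Commute (F x) (S y) := fun x y => by
      rw [← eS]; exact (hF x y).map (insertOnes Fin.castSuccEmb)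
    have hF1 : ∀ x y,
        Commute (((comulLast s (k + 1)).comp
          ((insertOnes Fin.castSuccEmb).comp (iterComul s k))) x)
        (((comulLast s (k + 1)).comp (single (Fin.last (k + 1)))) y) :=
      fun x y => (hF x y).map (comulLast s (k + 1))
    have hF2 : ∀ x y, Commute
        (((insertOnes Fin.castSuccEmb).comp ((insertOnes Fin.castSuccEmb).comp (iterComul s k))) x)
        (((insertOnes Fin.castSuccEmb).comp (single (U := Osp s) (Fin.last (k + 1)))) y) :=
      fun x y => (hF x y).map (insertOnes Fin.castSuccEmb)
    -- The last extension morphism acts only on the final factor, which it splits into `S ⋆ T`.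
    -- Reassociating `F ⋆ (S ⋆ T)` as `(F ⋆ S) ⋆ T` then makes the shorter iterated coproduct `F ⋆
    -- S` visible.
    have e1 : iterComul s (k + 2) = conv F (conv S T hST) fun x y =>
        (conv_commute hST (fun a b => (hFS b a).symm) (fun a b => (hFT b a).symm) y x).symm := by
      change (comulLast s (k + 1)).comp (iterComul s (k + 1)) = _
      rw [ih hF, comp_conv _ _ hF1]
      exact conv_congr _ eF (comulLast_comp_single (k + 1) hST) _
    have e2 : (insertOnes Fin.castSuccEmb).comp (iterComul s (k + 1)) = conv F S hFS := by
      rw [ih hF, comp_conv _ _ hF2]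
      exact conv_congr _ rfl eS _
    rw [e1, ← conv_assoc hFS hFT hST]
    exact conv_congr _ e2.symm rfl _

theorem Gam_eq_conv {n i j : ℕ} (h : 1 ≤ i ∧ i ≤ j ∧ j ≤ n) {k : ℕ} (hk : j - i = k + 1)
    (f : Fin (k + 1) ↪ Fin n) (hf : ∀ t, (f t : ℕ) = i - 1 + t) (p : Fin n)
    (hp : (p : ℕ) = j - 1)
    (hc : ∀ x y, Commute ((insertOnes f).comp (iterComul s k) x) (single p y)) :
    Gam s n i j h = conv ((insertOnes f).comp (iterComul s k)) (single p) hc (casimir s) := by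
  -- The length `j - i` sits in the type of the embedding, so it is first replaced by a variable
  -- `d`.
  have aux {d : ℕ} (hd : j - i = d) (e : Fin (d + 1) ↪ Fin n) (he : ∀ t, (e t : ℕ) = i - 1 + t) :
      Gam s n i j h = insertOnes e (iterComul s d (casimir s)) := by
    subst hd
    have : e = intervalEmb n i j h := by
      ext t
      exact he t
    rw [this, Gam]
  let e : Fin (k + 2) ↪ Fin n :=
    ⟨fun t => ⟨i - 1 + t, by omega⟩, fun a b hab => by simpa [Fin.ext_iff] using hab⟩
  have hF : ∀ x y, Commute ((insertOnes Fin.castSuccEmb).comp (iterComul s k) x)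
      (single (Fin.last (k + 1)) y) := fun x y => insertOnes_castSucc_commute _ _ _
  have hF' : ∀ x y,
      Commute (((insertOnes e).comp ((insertOnes Fin.castSuccEmb).comp (iterComul s k))) x)
      (((insertOnes e).comp (single (U := Osp s) (Fin.last (k + 1)))) y) :=
    fun x y => (hF x y).map (insertOnes e)
  have he : Fin.castSuccEmb.trans e = f := by
    ext t
    exact (hf t).symm
  have hp' : e (Fin.last (k + 1)) = p := by
    ext
    change i - 1 + (k + 1) = (p : ℕ)
    omega
  rw [aux hk e fun t => rfl, ← AlgHom.comp_apply, iterComul_succ k hF, comp_conv _ _ hF',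
    conv_congr _ _ _ hc]
  · rw [← AlgHom.comp_assoc, insertOnes_comp, he]
  · rw [insertOnes_comp_single, hp']

end QBannaiIto

end

open QBannaiIto in
/-- `q` is a non-zero complex number off the unit circle, `s` is a square root of `q` (the value of
`q ^ (1/2)`), and `2 ≤ m ≤ n - 1`. Then `A = Γ_{[m]}` and `A* = Γ_{{m, m+1}}` in
`osp_q(1|2)^{⊗n}` satisfy the tridiagonal relations. -/
theorem corollary2p9 (q : ℂ) (hq0 : q ≠ 0) (hq1 : ‖q‖ ≠ 1) (s : ℂ) (hs : s ^ 2 = q)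
    (n m : ℕ) (hm : 2 ≤ m) (hmn : m + 1 ≤ n) :
    TridiagonalRelations
      (Gam s n 1 m ⟨by omega, by omega, by omega⟩)
      (Gam s n m (m + 1) ⟨by omega, by omega, by omega⟩)
      (-(q + q⁻¹)) 0 0 1 1 := by
  -- The case `s² = ±1` would force `|q| = 1`.
  have h : Generic s := by
    subst hs
    refine ⟨by rintro rfl; simp at hq0, fun h => hq1 ?_, fun h => hq1 ?_⟩
    · rw [sub_eq_zero.mp h, norm_one]
    · rw [eq_neg_of_add_eq_zero_left h, norm_neg, norm_one]
  -- With `m = k + 2`, the positions `1, …, m - 1` form a non-empty block of length `k + 1`. Counted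
  -- from zero, position `m` is `p = k + 1` and position `m + 1` is `r = k + 2`.
  obtain ⟨k, rfl⟩ : ∃ k, m = k + 2 := ⟨m - 2, by omega⟩
  subst hs
  let f : Fin (k + 1) ↪ Fin n := ⟨fun t => ⟨t, by omega⟩, fun a b hab => by
    simpa [Fin.ext_iff] using hab⟩
  let g : Fin 1 ↪ Fin n := ⟨fun t => ⟨k + 1, by omega⟩, fun a b _ => Subsingleton.elim a b⟩
  let p : Fin n := ⟨k + 1, by omega⟩
  let r : Fin n := ⟨k + 2, by omega⟩
  have hfp : ∀ j, f j ≠ p := fun j hj => by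
    have : (j : ℕ) = k + 1 := congrArg Fin.val hj
    omega
  have hfr : ∀ j, f j ≠ r := fun j hj => by
    have : (j : ℕ) = k + 2 := congrArg Fin.val hj
    omega
  have hpr : p ≠ r := by simp [p, r]
  have hg : (insertOnes g).comp (iterComul s 0) = single p := insertOnes_comp_single g 0
  have hgr : ∀ x y, Commute ((insertOnes g).comp (iterComul s 0) x) (single r y) := by
    rw [hg]; exact single_commute_single hpr
  have hF : ∀ x y, Commute ((insertOnes f).comp (iterComul s k) x) (single p y) :=
    fun x y => insertOnes_commute_single f hfp _ _
  have hF' : ∀ x y, Commute ((insertOnes f).comp (iterComul s k) x) (single r y) :=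
    fun x y => insertOnes_commute_single f hfr _ _
  have hpr' : ∀ x y, Commute (single (U := Osp s) p x) (single r y) := single_commute_single hpr
  have hf (t : Fin (k + 1)) : (f t : ℕ) = 1 - 1 + t := (zero_add _).symm
  have hg' (t : Fin 1) : (g t : ℕ) = k + 2 - 1 + t := by
    rw [Subsingleton.elim t 0]; rfl
  rw [Gam_eq_conv _ (k := k) rfl f hf p rfl hF, Gam_eq_conv _ (k := 0) (by omega) g hg' r rfl hgr,
    Osp.conv_congr hgr hg rfl hpr']
  exact Osp.tridiagonalRelations_conv h hF hF' hpr'
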